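/- Let $n,k\in\mathbb{N}=\{0,1,2,\ldots\}$, and let $S_n$ be the group of all permutations of $[n]=\{1,2,\ldots,n\}$. A permutation $w\in S_n$ is said to avoid $12\cdots(k+1)$ if there is no $(k+1)$-element subset $U$ of $[n]$ such that the restriction $w|_U$ is increasing (i.e., if there are no $i_1<i_2<\cdots<i_{k+1}$ in $[n]$ with $w(i_1)<w(i_2)<\cdots<w(i_{k+1})$). For each partition $\lambda$ of $n$ (written $\lambda\vdash n$), let $\ell(\lambda)$ be the number of its (positive) parts, let $\lambda_1$ be its largest part (with $\lambda_1=0$ if $\lambda$ is empty), and let $f^\lambda$ be the number of standard tableaux of shape $\lambda$, i.e., of fillings of the Young diagram of $\lambda$ with the numbers $1,2,\ldots,n$, each used exactly once, whose entries strictly increase along each row (left to right) and down each column (top to bottom). Then the number of all permutations $w\in S_n$ that avoid $12\cdots(k+1)$ is $$\sum_{\substack{\lambda\vdash n;\\ \ell(\lambda)\le k}}(f^\lambda)^2=\sum_{\substack{\lambda\vdash n;\\ \lambda_1\le k}}(f^\lambda)^2 .$$ -/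

import Mathlib

/-- The entry `lam_(i+1)` of a partition `lam = (lam_1 ≥ lam_2 ≥ ⋯)`, extended by zeros
(so the index is 0-based: `lam.entry 0` is `lam_1`). -/
def Nat.Partition.entry {n : ℕ} (lam : n.Partition) (i : ℕ) : ℕ :=
  (lam.parts.sort (· ≥ ·)).getD i 0

/-- The length of a partition: the number of its (positive) parts. -/
def Nat.Partition.length {n : ℕ} (lam : n.Partition) : ℕ :=
  lam.parts.card

/-- The Young diagram of a partition: the row `i` has `lam.entry i` cells. -/
def Nat.Partition.diagram {n : ℕ} (lam : n.Partition) : YoungDiagram :=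
  YoungDiagram.ofRowLens (lam.parts.sort (· ≥ ·)) (Multiset.pairwise_sort _ _).sortedGE

/-- A standard tableau of shape `μ`: a filling of the cells of `μ` with the numbers
`1, 2, …, |μ|`, each used exactly once, such that the entries strictly increase along each row
(left to right) and down each column (top to bottom). -/
def StandardTableau (μ : YoungDiagram) : Type :=
  {T : μ.cells ≃ Finset.Icc 1 μ.card //
    (∀ c d : μ.cells, c.1.1 = d.1.1 → c.1.2 < d.1.2 → T c < T d) ∧
    (∀ c d : μ.cells, c.1.2 = d.1.2 → c.1.1 < d.1.1 → T c < T d)}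

instance (μ : YoungDiagram) : Fintype (StandardTableau μ) :=
  inferInstanceAs (Fintype {T : μ.cells ≃ Finset.Icc 1 μ.card //
    (∀ c d : μ.cells, c.1.1 = d.1.1 → c.1.2 < d.1.2 → T c < T d) ∧
    (∀ c d : μ.cells, c.1.2 = d.1.2 → c.1.1 < d.1.1 → T c < T d)})

/-- `f^lam`: the number of standard tableaux of shape `lam`. -/
def numStandardTableaux {n : ℕ} (lam : n.Partition) : ℕ :=
  Fintype.card (StandardTableau lam.diagram)

/-- The permutation `w` avoids the pattern `12⋯m`: there is no `m`-element subset of its domain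
on which `w` is increasing. -/
def AvoidsIncreasing {n : ℕ} (m : ℕ) (w : Equiv.Perm (Fin n)) : Prop :=
  ¬ ∃ U : Finset (Fin n), U.card = m ∧ StrictMonoOn w (U : Set (Fin n))

/-! The proof is the Robinson–Schensted correspondence by way of growth diagrams. Partitions, as
sequences of row lengths, sit at the vertices of a grid; two sides carry the empty partition, and a
local rule computes the fourth corner `t` of a cell from its other corners `l`, `m`, `v` and the
matrix entry `x`. The rule is reversible: `m`, `v`, `t` give back `l` and `x`. Hence a matrix is
determined by the two opposite sides of its diagram (`growth_injective`), and any two interlacing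
chains of `n` steps from the empty partition to a common end occur as those sides (`exists_growth`).

The size of a partition in the diagram is the sum of the matrix entries before its vertex
(`growth_sum`). So the matrices whose two chains add one box per step are exactly the permutation
matrices. Such a chain is a standard tableau: each cell records the step at which it appears.
Permutations thus correspond to pairs of tableaux of equal shape.

In row 0 the local rule reads `max (m 0) (v 0) + x`, the recursion for the longest increasing
subsequence. Hence avoidance of 12⋯(k+1) means that the largest part of the common shape is at most
`k`. Conjugating partitions turns this condition into a bound on the number of parts. -/

/-- Two sequences interlace when, read as partitions, they differ by a horizontal strip. -/
def Interlaces (a b : ℕ → ℕ) : Prop :=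
  ∀ r, a r ≤ b r ∧ b (r + 1) ≤ a r

/-- The local rule of the growth diagram of the Robinson–Schensted–Knuth correspondence. -/
def growthRule (l m v : ℕ → ℕ) (x : ℕ) : ℕ → ℕ
  | 0 => max (m 0) (v 0) + x
  | r + 1 => max (m (r + 1)) (v (r + 1)) + (min (m r) (v r) - l r)

/-- The inverse of the local rule. -/
def shrinkRule (m v t : ℕ → ℕ) (r : ℕ) : ℕ :=
  max (m (r + 1)) (v (r + 1)) + min (m r) (v r) - t (r + 1)

/-- The growth diagram of a matrix of natural numbers. -/
def growth (A : ℕ → ℕ → ℕ) : ℕ → ℕ → ℕ → ℕ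
  | 0, _ => 0
  | _ + 1, 0 => 0
  | i + 1, j + 1 => growthRule (growth A i j) (growth A (i + 1) j) (growth A i (j + 1)) (A i j)

/-- The diagram obtained from its boundary by the inverse local rule. -/
def shrink (p q : ℕ → ℕ → ℕ) : ℕ → ℕ → ℕ → ℕ
  | a, 0 => p a
  | 0, b + 1 => q (b + 1)
  | a + 1, b + 1 => shrinkRule (shrink p q a (b + 1)) (shrink p q (a + 1) b) (shrink p q a b)

/-! ### The local rule and its inverse -/

theorem interlaces_zero : Interlaces 0 0 := fun _ => ⟨le_rfl, le_rfl⟩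

theorem interlaces_growthRule {l m v : ℕ → ℕ} (hm : Interlaces l m) (hv : Interlaces l v) (x : ℕ) :
    Interlaces m (growthRule l m v x) ∧ Interlaces v (growthRule l m v x) := by
  refine ⟨fun r => ⟨?_, ?_⟩, fun r => ⟨?_, ?_⟩⟩
  · cases r <;> simp only [growthRule] <;> omega
  · have := hm r; have := hv r; simp only [growthRule]; omega
  · cases r <;> simp only [growthRule] <;> omega
  · have := hm r; have := hv r; simp only [growthRule]; omega

theorem interlaces_shrinkRule {m v t : ℕ → ℕ} (hm : Interlaces m t) (hv : Interlaces v t) :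
    Interlaces (shrinkRule m v t) m ∧ Interlaces (shrinkRule m v t) v := by
  refine ⟨fun r => ?_, fun r => ?_⟩ <;>
  · have := hm r; have := hv r; have := hm (r + 1); have := hv (r + 1)
    simp only [shrinkRule]; omega

theorem shrinkRule_growthRule {l m v : ℕ → ℕ} (hm : Interlaces l m) (hv : Interlaces l v) (x : ℕ) :
    shrinkRule m v (growthRule l m v x) = l := by
  funext r
  have := hm r; have := hv r
  simp only [shrinkRule, growthRule]; omega

/-- `shrinkRule` never reads `t 0`; that information is carried by the matrix entry `t 0 - max (m 0)
(v 0)`. -/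
theorem growthRule_shrinkRule {m v t : ℕ → ℕ} (hm : Interlaces m t) (hv : Interlaces v t) :
    growthRule (shrinkRule m v t) m v (t 0 - max (m 0) (v 0)) = t := by
  funext r
  cases r with
  | zero => have := hm 0; have := hv 0; simp only [growthRule]; omega
  | succ r =>
    have := hm r; have := hv r; have := hm (r + 1); have := hv (r + 1)
    simp only [shrinkRule, growthRule]; omega

/-- Since max + min is the sum, the rows telescope to |t| + |l| = |m| + |v| + x. The extra term is
what row `M` would pass on to row `M + 1`, beyond the truncation. -/
theorem growthRule_sum {l m v : ℕ → ℕ} (hm : Interlaces l m) (hv : Interlaces l v) (x M : ℕ) :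
    ∑ r ∈ Finset.range (M + 1), growthRule l m v x r + ∑ r ∈ Finset.range (M + 1), l r
      + (min (m M) (v M) - l M) =
    ∑ r ∈ Finset.range (M + 1), m r + ∑ r ∈ Finset.range (M + 1), v r + x := by
  induction M with
  | zero => have := hm 0; have := hv 0; simp [growthRule]; omega
  | succ M ih =>
    have := hm M; have := hv M; have := hm (M + 1); have := hv (M + 1)
    rw [Finset.sum_range_succ _ (M + 1), Finset.sum_range_succ l (M + 1),
      Finset.sum_range_succ m (M + 1), Finset.sum_range_succ v (M + 1),
      show growthRule l m v x (M + 1) = max (m (M + 1)) (v (M + 1)) + (min (m M) (v M) - l M)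
        from rfl]
    omega

/-! ### Growth diagrams of matrices -/

section Growth

variable (A : ℕ → ℕ → ℕ)

@[simp] theorem growth_zero_left (j : ℕ) : growth A 0 j = 0 := by rw [growth]

@[simp] theorem growth_zero_right (i : ℕ) : growth A i 0 = 0 := by cases i <;> rw [growth]

theorem growth_succ (i j : ℕ) : growth A (i + 1) (j + 1) =
    growthRule (growth A i j) (growth A (i + 1) j) (growth A i (j + 1)) (A i j) := by
  rw [growth]

theorem growth_interlaces (i : ℕ) :
    (∀ j, Interlaces (growth A i j) (growth A i (j + 1))) ∧
      ∀ j, Interlaces (growth A i j) (growth A (i + 1) j) := by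
  -- Each instance of the local rule needs one interlacing in each direction, so the two families
  -- are proved alternately, line by line.
  have key : ∀ i, (∀ j, Interlaces (growth A i j) (growth A i (j + 1))) →
      ∀ j, Interlaces (growth A i j) (growth A (i + 1) j) := by
    intro i h j
    induction j with
    | zero => simpa using interlaces_zero
    | succ j ih => rw [growth_succ]; exact (interlaces_growthRule ih (h j) _).2
  suffices h : ∀ j, Interlaces (growth A i j) (growth A i (j + 1)) from ⟨h, key i h⟩
  induction i with
  | zero => intro j; simpa using interlaces_zero
  | succ i ih =>
    intro j
    rw [growth_succ]
    exact (interlaces_growthRule (key i ih j) (ih j) _).1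

/-- Interlacing lets each step in `i` open at most one new row. -/
theorem growth_eq_zero (i j r : ℕ) (h : i ≤ r) : growth A i j r = 0 := by
  induction i generalizing r with
  | zero => simp
  | succ i ih =>
    obtain ⟨r, rfl⟩ : ∃ s, r = s + 1 := ⟨r - 1, by omega⟩
    have := ((growth_interlaces A i).2 j r).2
    have := ih r (by omega)
    omega

theorem growth_sum (n i j : ℕ) (hi : i ≤ n) :
    ∑ r ∈ Finset.range n, growth A i j r =
      ∑ a ∈ Finset.range i, ∑ b ∈ Finset.range j, A a b := by
  induction i generalizing j with
  | zero => simp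
  | succ i ih =>
    induction j with
    | zero => simp
    | succ j ihj =>
      obtain ⟨M, rfl⟩ : ∃ s, n = s + 1 := ⟨n - 1, by omega⟩
      have h := growthRule_sum ((growth_interlaces A i).2 j) ((growth_interlaces A i).1 j) (A i j) M
      rw [← growth_succ, growth_eq_zero A i (j + 1) M (by omega), ih j (by omega),
        ih (j + 1) (by omega), ihj] at h
      rw [Finset.sum_range_succ _ i] at h ⊢
      rw [Finset.sum_range_succ _ j]
      omega

end Growth

theorem growth_congr {A B : ℕ → ℕ → ℕ} {n : ℕ} (h : ∀ i < n, ∀ j < n, A i j = B i j) :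
    ∀ i ≤ n, ∀ j ≤ n, growth A i j = growth B i j := by
  intro i
  induction i with
  | zero => simp
  | succ i ih =>
    intro hi j
    induction j with
    | zero => simp
    | succ j ihj =>
      intro hj
      rw [growth_succ, growth_succ, ih (by omega) j (by omega), ih (by omega) (j + 1) hj,
        ihj (by omega), h i hi j hj]

theorem growth_injective {A B : ℕ → ℕ → ℕ} {n : ℕ} (hl : ∀ i ≤ n, growth A i n = growth B i n)
    (hr : ∀ j ≤ n, growth A n j = growth B n j) :
    ∀ i < n, ∀ j < n, A i j = B i j := by
  -- Downward induction from the far sides, run on the distances `a`, `b`; once a distance exceeds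
  -- `n`, truncated subtraction repeats an earlier case.
  have key : ∀ a b, growth A (n - a) (n - b) = growth B (n - a) (n - b) := by
    intro a
    induction a with
    | zero => intro b; exact hr _ (Nat.sub_le _ _)
    | succ a iha =>
      intro b
      induction b with
      | zero => exact hl _ (Nat.sub_le _ _)
      | succ b ihb =>
        rcases le_or_gt n a with h | h
        · rw [show n - (a + 1) = n - a by omega]; exact iha _
        rcases le_or_gt n b with h' | h'
        · rw [show n - (b + 1) = n - b by omega]; exact ihb
        have e1 := iha (b + 1)
        have e3 := iha b
        obtain ⟨i, hi⟩ : ∃ i, n - (a + 1) = i := ⟨_, rfl⟩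
        obtain ⟨j, hj⟩ : ∃ j, n - (b + 1) = j := ⟨_, rfl⟩
        rw [hi] at ihb ⊢
        rw [hj] at e1 ⊢
        rw [show n - a = i + 1 by omega] at e1 e3
        rw [show n - b = j + 1 by omega] at ihb e3
        rw [← shrinkRule_growthRule ((growth_interlaces A i).2 j) ((growth_interlaces A i).1 j)
          (A i j), ← shrinkRule_growthRule ((growth_interlaces B i).2 j)
          ((growth_interlaces B i).1 j) (B i j), ← growth_succ, ← growth_succ, e1, e3, ihb]
  have key' : ∀ i ≤ n, ∀ j ≤ n, growth A i j = growth B i j := by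
    intro i hi j hj
    have := key (n - i) (n - j)
    rwa [Nat.sub_sub_self hi, Nat.sub_sub_self hj] at this
  intro i hi j hj
  have h := congrFun (key' (i + 1) hi (j + 1) hj) 0
  rw [growth_succ, growth_succ] at h
  simp only [growthRule] at h
  rw [key' (i + 1) hi j hj.le, key' i hi.le (j + 1) hj] at h
  omega

/-! ### Reconstruction from the boundary -/

theorem shrink_succ (p q : ℕ → ℕ → ℕ) (a b : ℕ) : shrink p q (a + 1) (b + 1) =
    shrinkRule (shrink p q a (b + 1)) (shrink p q (a + 1) b) (shrink p q a b) := by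
  rw [shrink]

theorem shrink_zero_right (p q : ℕ → ℕ → ℕ) (a : ℕ) : shrink p q a 0 = p a := by
  rw [shrink]

theorem shrink_zero_left {p q : ℕ → ℕ → ℕ} (h : p 0 = q 0) (b : ℕ) : shrink p q 0 b = q b := by
  cases b <;> rw [shrink]; exact h

theorem shrink_interlaces {p q : ℕ → ℕ → ℕ} (h : p 0 = q 0)
    (hp : ∀ a, Interlaces (p (a + 1)) (p a)) (hq : ∀ b, Interlaces (q (b + 1)) (q b)) (a : ℕ) :
    (∀ b, Interlaces (shrink p q a (b + 1)) (shrink p q a b)) ∧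
      ∀ b, Interlaces (shrink p q (a + 1) b) (shrink p q a b) := by
  have key : ∀ a, (∀ b, Interlaces (shrink p q a (b + 1)) (shrink p q a b)) →
      ∀ b, Interlaces (shrink p q (a + 1) b) (shrink p q a b) := by
    intro a h b
    induction b with
    | zero => simpa only [shrink_zero_right] using hp a
    | succ b ih => rw [shrink_succ]; exact (interlaces_shrinkRule (h b) ih).1
  suffices h : ∀ b, Interlaces (shrink p q a (b + 1)) (shrink p q a b) from ⟨h, key a h⟩
  induction a with
  | zero => intro b; simpa only [shrink_zero_left h] using hq b
  | succ a ih =>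
    intro b
    rw [shrink_succ]
    exact (interlaces_shrinkRule (ih b) (key a ih b)).2

/-- Every pair of interlacing chains with the same end is the boundary of a growth diagram. -/
theorem exists_growth {p q : ℕ → ℕ → ℕ} {n : ℕ} (h : p 0 = q 0)
    (hp : ∀ a, Interlaces (p (a + 1)) (p a)) (hq : ∀ b, Interlaces (q (b + 1)) (q b))
    (hp0 : p n = 0) (hq0 : q n = 0) :
    ∃ A : ℕ → ℕ → ℕ, ∀ i ≤ n, ∀ j ≤ n, growth A i j = shrink p q (n - i) (n - j) := by
  have hle : ∀ b r, shrink p q n b r = 0 := by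
    intro b r
    induction b with
    | zero => simp [shrink_zero_right, hp0]
    | succ b ih => have := ((shrink_interlaces h hp hq n).1 b r).1; omega
  have hle' : ∀ a r, shrink p q a n r = 0 := by
    intro a r
    induction a with
    | zero => simp [shrink_zero_left h, hq0]
    | succ a ih => have := ((shrink_interlaces h hp hq a).2 n r).1; omega
  -- The entry is what row 0 of the local rule adds to the maximum; indices are reversed because
  -- `shrink` starts at the far corner.
  refine ⟨fun i j => shrink p q (n - (i + 1)) (n - (j + 1)) 0 -
    max (shrink p q (n - (i + 1)) (n - j) 0) (shrink p q (n - i) (n - (j + 1)) 0), ?_⟩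
  intro i
  induction i with
  | zero => intro _ j _; funext r; simp [hle]
  | succ i ih =>
    intro hi j
    induction j with
    | zero => intro _; funext r; simp [hle']
    | succ j ihj =>
      intro hj
      rw [growth_succ, ih (by omega) j (by omega), ih (by omega) (j + 1) hj, ihj (by omega)]
      obtain ⟨a, ha⟩ : ∃ a, n - (i + 1) = a := ⟨_, rfl⟩
      obtain ⟨b, hb⟩ : ∃ b, n - (j + 1) = b := ⟨_, rfl⟩
      rw [ha, hb, show n - i = a + 1 by omega, show n - j = b + 1 by omega, shrink_succ]
      exact growthRule_shrinkRule ((shrink_interlaces h hp hq a).1 b)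
        ((shrink_interlaces h hp hq a).2 b)

/-! ### Permutation matrices and standard chains -/

/-- A chain of partitions from the empty one to one of `n`, which adds one box at each of its
first `n` steps and is constant from then on. -/
structure IsStandardChain (n : ℕ) (P : ℕ → ℕ → ℕ) : Prop where
  zero : P 0 = 0
  interlaces : ∀ i < n, Interlaces (P i) (P (i + 1))
  sum : ∀ i ≤ n, ∑ r ∈ Finset.range n, P i r = i
  eventually_const : ∀ i, P (min i n) = P i

/-- The matrix of a permutation, extended by zeros. -/
def permMatrix {n : ℕ} (w : Equiv.Perm (Fin n)) (i j : ℕ) : ℕ :=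
  if ∃ u : Fin n, (u : ℕ) = i ∧ (w u : ℕ) = j then 1 else 0

section PermMatrix

variable {n : ℕ} (w : Equiv.Perm (Fin n))

theorem permMatrix_apply (u : Fin n) (j : ℕ) :
    permMatrix w u j = if (w u : ℕ) = j then 1 else 0 := by
  unfold permMatrix
  congr 1
  refine propext ⟨?_, fun h => ⟨u, rfl, h⟩⟩
  rintro ⟨v, hv, h⟩
  rwa [← Fin.ext hv]

theorem permMatrix_apply' (i : ℕ) (u : Fin n) :
    permMatrix w i (w u) = if (u : ℕ) = i then 1 else 0 := by
  unfold permMatrix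
  congr 1
  refine propext ⟨?_, fun h => ⟨u, h, rfl⟩⟩
  rintro ⟨v, hv, h⟩
  rwa [← w.injective (Fin.ext h)]

theorem permMatrix_sum_row (i : ℕ) (hi : i < n) : ∑ j ∈ Finset.range n, permMatrix w i j = 1 := by
  rw [Finset.sum_congr rfl fun j _ => permMatrix_apply w ⟨i, hi⟩ j]
  simp

theorem permMatrix_sum_col (j : ℕ) (hj : j < n) : ∑ i ∈ Finset.range n, permMatrix w i j = 1 := by
  have h : (w (w.symm ⟨j, hj⟩) : ℕ) = j := by simp
  have h' : ∀ i, permMatrix w i j = if (w.symm ⟨j, hj⟩ : ℕ) = i then 1 else 0 := fun i => by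
    simpa only [h] using permMatrix_apply' w i (w.symm ⟨j, hj⟩)
  rw [Finset.sum_congr rfl fun i _ => h' i]
  simp

/-- The first rows in the growth diagram are bounded below by the lengths of increasing
subsequences. -/
theorem card_le_growth (i j : ℕ) (U : Finset (Fin n)) (hU : StrictMonoOn w (U : Set (Fin n)))
    (hi : ∀ u ∈ U, (u : ℕ) < i) (hj : ∀ u ∈ U, (w u : ℕ) < j) :
    U.card ≤ growth (permMatrix w) i j 0 := by
  induction i generalizing j U with
  | zero =>
    rw [Finset.eq_empty_of_forall_notMem fun u hu => absurd (hi u hu) (by omega)]; simp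
  | succ i ih =>
    induction j generalizing U with
    | zero =>
      rw [Finset.eq_empty_of_forall_notMem fun u hu => absurd (hj u hu) (by omega)]; simp
    | succ j ihj =>
      rw [growth_succ]
      simp only [growthRule]
      by_cases h1 : ∃ u ∈ U, (u : ℕ) = i
      · obtain ⟨u, hu, rfl⟩ := h1
        by_cases h2 : (w u : ℕ) = j
        · have hlt : ∀ v ∈ U.erase u, (v : ℕ) < u := fun v hv => by
            have := hi v (Finset.mem_of_mem_erase hv)
            have : (v : ℕ) ≠ u := fun e => Finset.ne_of_mem_erase hv (Fin.ext e)
            omega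
          have hlt' : ∀ v ∈ U.erase u, (w v : ℕ) < j + 1 := fun v hv =>
            hj v (Finset.mem_of_mem_erase hv)
          have := ih (j + 1) (U.erase u) (hU.mono (by simp)) hlt hlt'
          rw [Finset.card_erase_of_mem hu] at this
          rw [permMatrix_apply, if_pos h2]
          omega
        -- The last element of `U` has the largest value, and that value is below `j`, so all values
        -- are.
        · have := ihj U hU hi fun v hv => by
            have h3 := hU.monotoneOn hv hu (by have := hi v hv; rw [Fin.le_def]; omega)
            have := hj u hu
            rw [Fin.le_def] at h3
            omega
          omega
      · have := ih (j + 1) U hU (fun v hv => by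
          have := hi v hv
          have : (v : ℕ) ≠ i := fun e => h1 ⟨v, hv, e⟩
          omega) hj
        omega

/-- The first rows in the growth diagram are lengths of increasing subsequences. -/
theorem exists_card_eq_growth (i j : ℕ) :
    ∃ U : Finset (Fin n), StrictMonoOn w (U : Set (Fin n)) ∧
      (∀ u ∈ U, (u : ℕ) < i) ∧ (∀ u ∈ U, (w u : ℕ) < j) ∧
      U.card = growth (permMatrix w) i j 0 := by
  induction i generalizing j with
  | zero => exact ⟨∅, by simp [StrictMonoOn]⟩
  | succ i ih =>
    induction j with
    | zero => exact ⟨∅, by simp [StrictMonoOn]⟩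
    | succ j ihj =>
      -- The fourth condition ensures that a matrix entry at `(i, j)` is not already used by `U`, so
      -- it can be appended.
      have hmax : ∃ U : Finset (Fin n), StrictMonoOn w (U : Set (Fin n)) ∧
          (∀ u ∈ U, (u : ℕ) < i + 1) ∧ (∀ u ∈ U, (w u : ℕ) < j + 1) ∧
          ((∀ u ∈ U, (u : ℕ) < i) ∨ (∀ u ∈ U, (w u : ℕ) < j)) ∧
          U.card = max (growth (permMatrix w) (i + 1) j 0) (growth (permMatrix w) i (j + 1) 0) := by
        rcases le_total (growth (permMatrix w) (i + 1) j 0) (growth (permMatrix w) i (j + 1) 0)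
          with h | h
        · obtain ⟨U, h1, h2, h3, h4⟩ := ih (j + 1)
          exact ⟨U, h1, fun u hu => (h2 u hu).trans (Nat.lt_succ_self i), h3, Or.inl h2, by
            rw [h4, max_eq_right h]⟩
        · obtain ⟨U, h1, h2, h3, h4⟩ := ihj
          exact ⟨U, h1, h2, fun u hu => (h3 u hu).trans (Nat.lt_succ_self j), Or.inr h3, by
            rw [h4, max_eq_left h]⟩
      obtain ⟨U, h1, h2, h3, h4, h5⟩ := hmax
      rw [growth_succ]
      simp only [growthRule]
      by_cases hx : ∃ u : Fin n, (u : ℕ) = i ∧ (w u : ℕ) = j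
      · obtain ⟨x, rfl, rfl⟩ := hx
        have hxU : x ∉ U := fun hx => by
          rcases h4 with h | h
          · exact lt_irrefl _ (h x hx)
          · exact lt_irrefl _ (h x hx)
        have hne : ∀ u ∈ U, u ≠ x := fun u hu e => hxU (e ▸ hu)
        have hlt : ∀ u ∈ U, u < x := fun u hu =>
          lt_of_le_of_ne (Nat.lt_succ_iff.1 (h2 u hu)) (hne u hu)
        have hlt' : ∀ u ∈ U, w u < w x := fun u hu =>
          lt_of_le_of_ne (Nat.lt_succ_iff.1 (h3 u hu)) fun e => hne u hu (w.injective e)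
        refine ⟨insert x U, ?_, ?_, ?_, ?_⟩
        · intro a ha b hb hab
          rw [Finset.mem_coe, Finset.mem_insert] at ha hb
          rcases ha with rfl | ha <;> rcases hb with rfl | hb
          · exact absurd hab (lt_irrefl _)
          · exact absurd hab (hlt b hb).asymm
          · exact hlt' a ha
          · exact h1 ha hb hab
        · simpa using fun u hu => h2 u hu
        · simpa using fun u hu => h3 u hu
        · rw [Finset.card_insert_of_notMem hxU, h5, permMatrix_apply, if_pos rfl]
      · exact ⟨U, h1, h2, h3, by rw [h5, permMatrix, if_neg hx, add_zero]⟩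

theorem avoidsIncreasing_iff (k : ℕ) :
    AvoidsIncreasing (k + 1) w ↔ growth (permMatrix w) n n 0 ≤ k := by
  constructor
  · intro h
    by_contra! hk
    obtain ⟨U, hU, -, -, hc⟩ := exists_card_eq_growth w n n
    obtain ⟨V, hV, hVc⟩ := Finset.exists_subset_card_eq (show k + 1 ≤ U.card by omega)
    exact h ⟨V, hVc, hU.mono (Finset.coe_subset.2 hV)⟩
  · rintro h ⟨U, hc, hU⟩
    have := card_le_growth w n n U hU (fun u _ => u.2) (fun u _ => (w u).2)
    omega

theorem isStandardChain_left :
    IsStandardChain n fun i => growth (permMatrix w) (min i n) n where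
  zero := by simp
  interlaces i hi := by
    rw [min_eq_left hi.le, min_eq_left (by omega : i + 1 ≤ n)]
    exact (growth_interlaces _ i).2 n
  sum i hi := by
    rw [min_eq_left hi, growth_sum _ _ _ _ hi, Finset.sum_congr rfl fun a ha =>
      permMatrix_sum_row w a ((Finset.mem_range.1 ha).trans_le hi)]
    simp
  eventually_const i := by simp

theorem isStandardChain_right :
    IsStandardChain n fun j => growth (permMatrix w) n (min j n) where
  zero := by simp
  interlaces i hi := by
    rw [min_eq_left hi.le, min_eq_left (by omega : i + 1 ≤ n)]
    exact (growth_interlaces _ n).1 i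
  sum i hi := by
    rw [min_eq_left hi, growth_sum _ _ _ _ le_rfl, Finset.sum_comm, Finset.sum_congr rfl fun a ha =>
      permMatrix_sum_col w a ((Finset.mem_range.1 ha).trans_le hi)]
    simp
  eventually_const i := by simp

end PermMatrix

theorem permMatrix_injective {n : ℕ} {w v : Equiv.Perm (Fin n)}
    (h : ∀ i < n, ∀ j < n, permMatrix w i j = permMatrix v i j) : w = v := by
  ext u
  have := h u u.2 (w u) (w u).2
  rw [permMatrix_apply, permMatrix_apply, if_pos rfl] at this
  by_contra hne
  rw [if_neg fun e => hne e.symm] at this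
  omega

/-- A matrix with row and column sums equal to `1` is the matrix of a permutation. -/
theorem exists_permMatrix_eq {n : ℕ} {A : ℕ → ℕ → ℕ}
    (hr : ∀ i < n, ∑ j ∈ Finset.range n, A i j = 1)
    (hc : ∀ j < n, ∑ i ∈ Finset.range n, A i j = 1) :
    ∃ w : Equiv.Perm (Fin n), ∀ i < n, ∀ j < n, permMatrix w i j = A i j := by
  have hex : ∀ i : Fin n, ∃ j : Fin n, A i j ≠ 0 := by
    intro i
    obtain ⟨j, hj, h⟩ := Finset.exists_ne_zero_of_sum_ne_zero
      (show ∑ j ∈ Finset.range n, A i j ≠ 0 by rw [hr i i.2]; exact one_ne_zero)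
    exact ⟨⟨j, Finset.mem_range.1 hj⟩, h⟩
  have huniq : ∀ (f : ℕ → ℕ), ∑ j ∈ Finset.range n, f j = 1 → ∀ a < n, f a ≠ 0 →
      f a = 1 ∧ ∀ b < n, b ≠ a → f b = 0 := by
    intro f hf a ha h
    have := Finset.add_sum_erase (Finset.range n) f (Finset.mem_range.2 ha)
    refine ⟨by omega, fun b hb hne => ?_⟩
    have h0 : ∑ j ∈ (Finset.range n).erase a, f j = 0 := by omega
    exact Finset.sum_eq_zero_iff.1 h0 b (Finset.mem_erase.2 ⟨hne, Finset.mem_range.2 hb⟩)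
  choose f hf using hex
  have hinj : Function.Injective f := by
    intro a b hab
    by_contra hne
    have h1 := (huniq (fun i => A i (f a)) (hc (f a) (f a).2) a a.2 (hf a)).2 b b.2
      fun e => hne (Fin.ext e.symm)
    have h2 := hf b
    rw [← hab] at h2
    exact h2 h1
  refine ⟨Equiv.ofBijective f (Finite.injective_iff_bijective.1 hinj), fun i hi j hj => ?_⟩
  have h := permMatrix_apply (Equiv.ofBijective f (Finite.injective_iff_bijective.1 hinj)) ⟨i, hi⟩ j
  have h' := huniq (A i) (hr i hi) (f ⟨i, hi⟩) (f ⟨i, hi⟩).2 (hf ⟨i, hi⟩)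
  simp only [Equiv.ofBijective_apply] at h
  rw [h]
  split_ifs with e
  · rw [← e, h'.1]
  · exact (h'.2 j hj fun e' => e e'.symm).symm

/-- The Robinson–Schensted correspondence, in terms of chains of partitions. -/
theorem exists_perm_of_chains {n : ℕ} {P Q : ℕ → ℕ → ℕ} (hP : IsStandardChain n P)
    (hQ : IsStandardChain n Q) (h : P n = Q n) :
    ∃ w : Equiv.Perm (Fin n), (fun i => growth (permMatrix w) (min i n) n) = P ∧
      (fun j => growth (permMatrix w) n (min j n)) = Q := by
  have hint : ∀ {P}, IsStandardChain n P → ∀ a, Interlaces (P (n - (a + 1))) (P (n - a)) := by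
    intro P hP a
    rcases lt_or_ge a n with ha | ha
    · have := hP.interlaces (n - (a + 1)) (by omega)
      rwa [show n - (a + 1) + 1 = n - a by omega] at this
    · rw [show n - (a + 1) = 0 by omega, show n - a = 0 by omega, hP.zero]
      exact interlaces_zero
  have h0 : (fun a => P (n - a)) 0 = (fun a => Q (n - a)) 0 := h
  obtain ⟨A, hA⟩ := exists_growth (p := fun a => P (n - a)) (q := fun a => Q (n - a)) (n := n)
    h0 (hint hP) (hint hQ) (by simp [hP.zero]) (by simp [hQ.zero])
  have hAQ : ∀ j ≤ n, growth A n j = Q j := fun j hj => by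
    rw [hA n le_rfl j hj, Nat.sub_self, shrink_zero_left h0, Nat.sub_sub_self hj]
  have hAP : ∀ i ≤ n, growth A i n = P i := fun i hi => by
    rw [hA i hi n le_rfl, Nat.sub_self, shrink_zero_right, Nat.sub_sub_self hi]
  -- Row and column sums of `A` are differences of consecutive sizes in the two chains, hence 1.
  obtain ⟨w, hw⟩ := exists_permMatrix_eq (n := n) (A := A)
    (fun i hi => by
      have h1 := growth_sum A n i n hi.le
      have h2 := growth_sum A n (i + 1) n hi
      rw [hAP _ hi.le, hP.sum _ hi.le] at h1
      rw [hAP _ hi, hP.sum _ hi, Finset.sum_range_succ] at h2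
      omega)
    (fun j hj => by
      have h1 := growth_sum A n n j le_rfl
      have h2 := growth_sum A n n (j + 1) le_rfl
      rw [hAQ _ hj.le, hQ.sum _ hj.le, Finset.sum_comm] at h1
      rw [hAQ _ hj, hQ.sum _ hj, Finset.sum_comm, Finset.sum_range_succ] at h2
      omega)
  refine ⟨w, funext fun i => ?_, funext fun j => ?_⟩
  · rw [growth_congr hw _ (min_le_right _ _) _ le_rfl, hAP _ (min_le_right _ _), hP.eventually_const]
  · rw [growth_congr hw _ le_rfl _ (min_le_right _ _), hAQ _ (min_le_right _ _), hQ.eventually_const]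

theorem chains_injective {n : ℕ} {w v : Equiv.Perm (Fin n)}
    (hl : (fun i => growth (permMatrix w) (min i n) n) = fun i => growth (permMatrix v) (min i n) n)
    (hr : (fun i => growth (permMatrix w) n (min i n)) =
      fun i => growth (permMatrix v) n (min i n)) : w = v := by
  refine permMatrix_injective (growth_injective (fun i hi => ?_) fun j hj => ?_)
  · simpa only [min_eq_left hi] using congrFun hl i
  · simpa only [min_eq_left hj] using congrFun hr j

/-! ### Young diagrams as row-length sequences -/

namespace YoungDiagram

theorem rowLen_eq_zero_of_card_le (μ : YoungDiagram) {n r : ℕ} (hμ : μ.card ≤ n) (hr : n ≤ r) :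
    μ.rowLen r = 0 := by
  by_contra h
  have hmem : ∀ i ∈ Finset.range (r + 1), (i, 0) ∈ μ.cells := fun i hi =>
    μ.up_left_mem (Nat.lt_succ_iff.1 (Finset.mem_range.1 hi)) le_rfl
      (mem_iff_lt_rowLen.2 (Nat.pos_of_ne_zero h))
  have := Finset.card_le_card_of_injOn (fun i => (i, 0)) hmem (fun a _ b _ h => by simpa using h)
  rw [Finset.card_range] at this
  change r + 1 ≤ μ.card at this
  omega

theorem sum_rowLen (μ : YoungDiagram) {n : ℕ} (h : ∀ r, n ≤ r → μ.rowLen r = 0) :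
    ∑ r ∈ Finset.range n, μ.rowLen r = μ.card := by
  rw [show μ.card = _ from Finset.card_eq_sum_card_fiberwise (f := Prod.fst) (t := Finset.range n)
    fun c hc => Finset.mem_coe.2 (Finset.mem_range.2 (by
      by_contra hn
      have := mem_iff_lt_rowLen.1 (show (c.1, c.2) ∈ μ from hc)
      have := h c.1 (not_lt.1 hn)
      omega))]
  exact Finset.sum_congr rfl fun r _ => μ.rowLen_eq_card

theorem rowLen_injective : Function.Injective rowLen := by
  intro μ ν h
  ext ⟨i, j⟩
  rw [mem_cells, mem_cells, mem_iff_lt_rowLen, mem_iff_lt_rowLen, h]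

/-- Every antitone sequence which is eventually zero is the sequence of row lengths of a Young
diagram. -/
theorem exists_rowLen_eq {s : ℕ → ℕ} {n : ℕ} (hs : Antitone s) (h : ∀ r, n ≤ r → s r = 0) :
    ∃ μ : YoungDiagram, μ.rowLen = s := by
  have hmem : ∀ c : ℕ × ℕ, c ∈ (Finset.range n ×ˢ Finset.range (s 0)).filter
      (fun c => c.2 < s c.1) ↔ c.2 < s c.1 := by
    intro c
    simp only [Finset.mem_filter, Finset.mem_product, Finset.mem_range, and_iff_right_iff_imp]
    intro hc
    refine ⟨?_, hc.trans_le (hs (Nat.zero_le _))⟩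
    by_contra hn
    rw [h _ (not_lt.1 hn)] at hc
    omega
  refine ⟨⟨(Finset.range n ×ˢ Finset.range (s 0)).filter fun c => c.2 < s c.1, ?_⟩, ?_⟩
  · intro c d hdc hc
    rw [Finset.mem_coe, hmem] at hc ⊢
    exact (hdc.2.trans_lt hc).trans_le (hs hdc.1)
  · funext r
    refine eq_of_forall_lt_iff fun c => ?_
    exact mem_iff_lt_rowLen.symm.trans (hmem (r, c))

end YoungDiagram

/-! ### From standard tableaux to chains -/

namespace StandardTableau

variable {μ : YoungDiagram}

theorem strictMono_cell (T : StandardTableau μ) {c d : μ.cells} (h : c.1 < d.1) :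
    T.1 c < T.1 d := by
  have hle := h.le
  -- Pass from `c` to `d` through the cell in the row of `d` and the column of `c`.
  have hmem : (d.1.1, c.1.2) ∈ μ.cells := μ.up_left_mem le_rfl hle.2 d.2
  have h1 : T.1 c ≤ T.1 ⟨_, hmem⟩ := by
    rcases hle.1.eq_or_lt with e | e
    · exact le_of_eq (congrArg _ (Subtype.ext (Prod.ext e rfl)))
    · exact (T.2.2 c ⟨_, hmem⟩ rfl e).le
  have h2 : T.1 ⟨_, hmem⟩ ≤ T.1 d := by
    rcases hle.2.eq_or_lt with e | e
    · exact le_of_eq (congrArg _ (Subtype.ext (Prod.ext rfl e)))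
    · exact (T.2.1 ⟨_, hmem⟩ d rfl e).le
  exact lt_of_le_of_ne (h1.trans h2) fun e => h.ne (congrArg _ (T.1.injective e))

/-- The shape of the part of a standard tableau with entries at most `i`. -/
def initial (T : StandardTableau μ) (i : ℕ) : YoungDiagram where
  cells := (Finset.univ.filter fun c : μ.cells => (T.1 c : ℕ) ≤ i).map (Function.Embedding.subtype _)
  isLowerSet := by
    intro c d hdc hc
    simp only [Finset.coe_map, Set.mem_image, Finset.mem_coe, Finset.mem_filter, Finset.mem_univ,
      true_and, Function.Embedding.subtype_apply] at hc ⊢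
    obtain ⟨c, hc, rfl⟩ := hc
    refine ⟨⟨d, μ.isLowerSet hdc c.2⟩, ?_, rfl⟩
    rcases hdc.eq_or_lt with rfl | h
    · exact hc
    · exact (show (T.1 ⟨d, _⟩ : ℕ) < T.1 c from T.strictMono_cell h).le.trans hc

theorem mem_initial (T : StandardTableau μ) (i : ℕ) (c : ℕ × ℕ) :
    c ∈ T.initial i ↔ ∃ h : c ∈ μ.cells, (T.1 ⟨c, h⟩ : ℕ) ≤ i := by
  rw [← YoungDiagram.mem_cells]
  simp [initial, and_comm]

theorem card_initial (T : StandardTableau μ) {i : ℕ} (hi : i ≤ μ.card) :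
    (T.initial i).card = i := by
  have : (T.initial i).cells.card = (Finset.Icc 1 i).card := by
    rw [initial, Finset.card_map]
    refine Finset.card_bij (fun c _ => (T.1 c : ℕ)) ?_ ?_ ?_
    · intro c hc
      exact Finset.mem_Icc.2 ⟨(Finset.mem_Icc.1 (T.1 c).2).1, (Finset.mem_filter.1 hc).2⟩
    · intro a _ b _ h
      exact T.1.injective (Subtype.ext h)
    · intro b hb
      rw [Finset.mem_Icc] at hb
      exact ⟨T.1.symm ⟨b, Finset.mem_Icc.2 ⟨hb.1, hb.2.trans hi⟩⟩, by simp [hb.2], by simp⟩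
  simpa using this

theorem initial_of_card_le (T : StandardTableau μ) {i : ℕ} (hi : μ.card ≤ i) :
    T.initial i = μ := by
  refine SetLike.ext fun c => ?_
  rw [mem_initial]
  exact ⟨fun ⟨h, _⟩ => h, fun h => ⟨h, (Finset.mem_Icc.1 (T.1 ⟨c, h⟩).2).2.trans hi⟩⟩

/-- The chain of the shapes of the initial parts of a standard tableau. -/
def chain (T : StandardTableau μ) (i : ℕ) : ℕ → ℕ :=
  (T.initial i).rowLen

/-- This is the dictionary between the two descriptions: the entry of a cell is the first step at
which the chain contains it. -/
theorem lt_chain_iff (T : StandardTableau μ) (i : ℕ) (c : μ.cells) :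
    c.1.2 < T.chain i c.1.1 ↔ (T.1 c : ℕ) ≤ i := by
  rw [chain, ← YoungDiagram.mem_iff_lt_rowLen, mem_initial]
  exact ⟨fun ⟨_, h⟩ => h, fun h => ⟨c.2, h⟩⟩

theorem chain_card (T : StandardTableau μ) : T.chain μ.card = μ.rowLen := by
  rw [chain, T.initial_of_card_le le_rfl]

theorem isStandardChain_chain (T : StandardTableau μ) : IsStandardChain μ.card T.chain where
  zero := by
    funext r
    exact YoungDiagram.rowLen_eq_zero_of_card_le _ (T.card_initial (Nat.zero_le _)).le
      (Nat.zero_le r)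
  interlaces i hi r := by
    constructor
    · by_contra! h
      obtain ⟨hc, h'⟩ := (T.mem_initial i _).1 (YoungDiagram.mem_iff_lt_rowLen.2 h)
      exact lt_irrefl _ ((T.lt_chain_iff (i + 1) ⟨_, hc⟩).2 (h'.trans (Nat.le_succ i)))
    · by_contra! h
      obtain ⟨hc, h'⟩ := (T.mem_initial (i + 1) _).1 (YoungDiagram.mem_iff_lt_rowLen.2 h)
      have hc' : (r, T.chain i r) ∈ μ.cells := μ.up_left_mem (Nat.le_succ r) le_rfl hc
      have hlt : (T.1 ⟨_, hc'⟩ : ℕ) < T.1 ⟨_, hc⟩ := T.2.2 ⟨_, hc'⟩ ⟨_, hc⟩ rfl (Nat.lt_succ_self r)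
      exact lt_irrefl _ ((T.lt_chain_iff i ⟨_, hc'⟩).2 (by omega))
  sum i hi := by
    refine (YoungDiagram.sum_rowLen _ fun r hr => ?_).trans (T.card_initial hi)
    exact YoungDiagram.rowLen_eq_zero_of_card_le _ (T.card_initial hi).le (hi.trans hr)
  eventually_const i := by
    rcases le_total i μ.card with h | h
    · rw [min_eq_left h]
    · rw [min_eq_right h, chain, chain, T.initial_of_card_le le_rfl, T.initial_of_card_le h]

theorem chain_injective : Function.Injective (chain (μ := μ)) := by
  intro S T h
  refine Subtype.ext (Equiv.ext fun c => Subtype.ext (eq_of_forall_ge_iff fun i => ?_))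
  rw [← lt_chain_iff, ← lt_chain_iff, h]

end StandardTableau

/-! ### From chains to standard tableaux -/

namespace IsStandardChain

variable {n : ℕ} {P : ℕ → ℕ → ℕ}

theorem monotone (hP : IsStandardChain n P) (r : ℕ) : Monotone fun i => P i r := by
  refine monotone_nat_of_le_succ fun i => ?_
  rcases lt_or_ge i n with h | h
  · exact (hP.interlaces i h r).1
  · rw [← hP.eventually_const i, ← hP.eventually_const (i + 1), min_eq_right h,
      min_eq_right (by omega : n ≤ i + 1)]

theorem antitone (hP : IsStandardChain n P) (i : ℕ) : Antitone (P i) := by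
  refine antitone_nat_of_succ_le fun r => ?_
  rw [← hP.eventually_const i]
  rcases Nat.eq_zero_or_pos (min i n) with h | h
  · rw [h, hP.zero]; rfl
  · obtain ⟨j, hj⟩ : ∃ j, min i n = j + 1 := ⟨min i n - 1, by omega⟩
    rw [hj]
    exact (hP.interlaces j (by omega) r).2.trans (hP.interlaces j (by omega) r).1

theorem eq_zero (hP : IsStandardChain n P) {i r : ℕ} (hi : i ≤ n) (hr : i ≤ r) : P i r = 0 := by
  induction i generalizing r with
  | zero => rw [hP.zero]; rfl
  | succ i ih =>
    obtain ⟨r, rfl⟩ : ∃ s, r = s + 1 := ⟨r - 1, by omega⟩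
    have := (hP.interlaces i hi r).2
    have := ih (r := r) (by omega) (by omega)
    omega

/-- At most one box is added at each step of a standard chain. -/
theorem eq_of_step (hP : IsStandardChain n P) {i r r' c c' : ℕ} (hi : i < n) (h1 : P i r ≤ c)
    (h2 : c < P (i + 1) r) (h1' : P i r' ≤ c') (h2' : c' < P (i + 1) r') : r = r' ∧ c = c' := by
  have hlt : ∀ r c, c < P (i + 1) r → r ∈ Finset.range n := fun r c h => by
    rw [Finset.mem_range]
    by_contra hn
    rw [hP.eq_zero hi (by omega)] at h
    omega
  have hr := hlt r c h2
  have hle : ∀ r ∈ Finset.range n, P i r ≤ P (i + 1) r := fun r _ => (hP.interlaces i hi r).1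
  have e := Finset.add_sum_erase _ (P i) hr
  have e' := Finset.add_sum_erase _ (P (i + 1)) hr
  rw [hP.sum _ hi.le] at e
  rw [hP.sum _ hi] at e'
  -- The whole size grows by 1, so growth in row `r` leaves none for the other rows.
  have hle' : ∑ s ∈ (Finset.range n).erase r, P i s ≤ ∑ s ∈ (Finset.range n).erase r, P (i + 1) s :=
    Finset.sum_le_sum fun s hs => hle s (Finset.mem_of_mem_erase hs)
  by_cases hrr : r = r'
  · subst hrr
    exact ⟨rfl, by omega⟩
  · have : ∑ s ∈ (Finset.range n).erase r, P i s < ∑ s ∈ (Finset.range n).erase r, P (i + 1) s :=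
      Finset.sum_lt_sum (fun s hs => hle s (Finset.mem_of_mem_erase hs))
        ⟨r', Finset.mem_erase.2 ⟨fun h => hrr h.symm, hlt r' c' h2'⟩, by omega⟩
    omega

/-- Every standard chain comes from a standard tableau. -/
theorem exists_chain_eq {μ : YoungDiagram} (hP : IsStandardChain μ.card P)
    (h : P μ.card = μ.rowLen) : ∃ T : StandardTableau μ, T.chain = P := by
  have hex : ∀ c : μ.cells, ∃ i, c.1.2 < P i c.1.1 := fun c =>
    ⟨μ.card, by rw [h]; exact YoungDiagram.mem_iff_lt_rowLen.1 c.2⟩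
  -- The entry of a cell is its time of appearance; `eq_of_step` makes entries distinct.
  let f : μ.cells → ℕ := fun c => Nat.find (hex c)
  have hf : ∀ c i, f c ≤ i ↔ c.1.2 < P i c.1.1 := fun c i =>
    ⟨fun hi => (Nat.find_spec (hex c)).trans_le (hP.monotone _ hi), Nat.find_min' (hex c)⟩
  have hf1 : ∀ c, f c ∈ Finset.Icc 1 μ.card := fun c => by
    refine Finset.mem_Icc.2 ⟨?_, ?_⟩
    · by_contra hn
      have := (hf c 0).1 (by omega)
      rw [hP.zero] at this
      exact Nat.not_lt_zero _ this
    · rw [hf, h]; exact YoungDiagram.mem_iff_lt_rowLen.1 c.2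
  have hinj : Function.Injective f := by
    intro c d hcd
    have hc := Finset.mem_Icc.1 (hf1 c)
    obtain ⟨i, hi⟩ : ∃ i, f c = i + 1 := ⟨f c - 1, by omega⟩
    have hd := hcd.symm.trans hi
    obtain ⟨e1, e2⟩ := hP.eq_of_step (i := i) (by omega)
      (not_lt.1 (mt (hf c i).2 (by omega))) ((hf c (i + 1)).1 hi.le)
      (not_lt.1 (mt (hf d i).2 (by omega))) ((hf d (i + 1)).1 hd.le)
    exact Subtype.ext (Prod.ext e1 e2)
  let g : μ.cells → Finset.Icc 1 μ.card := fun c => ⟨f c, hf1 c⟩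
  have hg : Function.Bijective g := by
    rw [Fintype.bijective_iff_injective_and_card]
    exact ⟨fun c d h => hinj (congrArg Subtype.val h), by simp⟩
  have hmono : ∀ c d : μ.cells, c.1 < d.1 → f c < f d := fun c d hcd => by
    refine lt_of_le_of_ne ((hf c _).2 ?_) fun e => hcd.ne (congrArg _ (hinj e))
    exact (hcd.le.2.trans_lt ((hf d _).1 le_rfl)).trans_le (hP.antitone _ hcd.le.1)
  refine ⟨⟨Equiv.ofBijective g hg, fun c d e hlt => hmono c d ?_, fun c d e hlt => hmono c d ?_⟩, ?_⟩
  · exact Prod.lt_iff.2 (Or.inr ⟨e.le, hlt⟩)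
  · exact Prod.lt_iff.2 (Or.inl ⟨hlt, e.le⟩)
  · funext i r
    refine eq_of_forall_lt_iff fun c => ?_
    by_cases hc : (r, c) ∈ μ.cells
    · exact (StandardTableau.lt_chain_iff _ i ⟨_, hc⟩).trans (hf ⟨_, hc⟩ i)
    · refine iff_of_false (fun hlt => ?_) fun hlt => ?_
      · exact hc ((StandardTableau.mem_initial _ _ _).1 (YoungDiagram.mem_iff_lt_rowLen.2 hlt)).1
      · rw [← hP.eventually_const i] at hlt
        refine hc (YoungDiagram.mem_iff_lt_rowLen.2 ?_)
        rw [← h]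
        exact hlt.trans_le (hP.monotone r (min_le_right _ _))

end IsStandardChain

/-! ### Partitions, diagrams and conjugation -/

theorem YoungDiagram.card_transpose (μ : YoungDiagram) : μ.transpose.card = μ.card :=
  Finset.card_map _

namespace Nat.Partition

variable {n : ℕ}

theorem pos_of_mem_sort (lam : n.Partition) : ∀ x ∈ lam.parts.sort (· ≥ ·), 0 < x :=
  fun _ hx => lam.parts_pos ((Multiset.mem_sort _).1 hx)

theorem rowLens_diagram (lam : n.Partition) :
    lam.diagram.rowLens = lam.parts.sort (· ≥ ·) :=
  YoungDiagram.rowLens_ofRowLens_eq_self lam.pos_of_mem_sort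

theorem rowLen_diagram (lam : n.Partition) (i : ℕ) : lam.diagram.rowLen i = lam.entry i := by
  refine eq_of_forall_lt_iff fun c => ?_
  rw [← YoungDiagram.mem_iff_lt_rowLen, diagram, YoungDiagram.mem_ofRowLens, entry]
  by_cases h : i < (lam.parts.sort (· ≥ ·)).length
  · rw [List.getD_eq_getElem _ _ h]
    exact ⟨fun ⟨_, h'⟩ => h', fun h' => ⟨h, h'⟩⟩
  · rw [List.getD_eq_default _ _ (not_lt.1 h)]
    exact ⟨fun ⟨h', _⟩ => absurd h' h, fun h' => absurd h' (Nat.not_lt_zero _)⟩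

theorem colLen_diagram (lam : n.Partition) : lam.diagram.colLen 0 = lam.length := by
  rw [← YoungDiagram.length_rowLens, rowLens_diagram, Multiset.length_sort, length]

theorem diagram_injective : Function.Injective (diagram (n := n)) := by
  intro lam lam' h
  have := congrArg YoungDiagram.rowLens h
  rw [rowLens_diagram, rowLens_diagram] at this
  refine Nat.Partition.ext ?_
  rw [← Multiset.sort_eq lam.parts (· ≥ ·), this, Multiset.sort_eq]

theorem _root_.YoungDiagram.sum_rowLens (μ : YoungDiagram) : μ.rowLens.sum = μ.card := by
  rw [← μ.sum_rowLen (n := μ.colLen 0)]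
  · exact (Multiset.sum_coe _).symm
  · intro r hr
    by_contra h
    have := YoungDiagram.mem_iff_lt_colLen.1
      (YoungDiagram.mem_iff_lt_rowLen.2 (Nat.pos_of_ne_zero h))
    omega

theorem card_diagram (lam : n.Partition) : lam.diagram.card = n := by
  rw [← YoungDiagram.sum_rowLens, rowLens_diagram, ← Multiset.sum_coe, Multiset.sort_eq,
    lam.parts_sum]

theorem exists_diagram_eq {μ : YoungDiagram} (h : μ.card = n) : ∃ lam : n.Partition,
    lam.diagram = μ := by
  refine ⟨⟨μ.rowLens, fun hx => μ.pos_of_mem_rowLens _ hx, ?_⟩, ?_⟩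
  · rw [Multiset.sum_coe, YoungDiagram.sum_rowLens, h]
  · unfold diagram
    conv_rhs => rw [← YoungDiagram.ofRowLens_to_rowLens_eq_self (μ := μ)]
    congr 1
    rw [Multiset.coe_sort]
    exact List.mergeSort_eq_self _ μ.rowLens_sorted.pairwise

theorem card_transpose_diagram (lam : n.Partition) : lam.diagram.transpose.card = n := by
  rw [YoungDiagram.card_transpose, card_diagram]

/-- The conjugate partition. -/
noncomputable def conj (lam : n.Partition) : n.Partition :=
  (exists_diagram_eq lam.card_transpose_diagram).choose

theorem diagram_conj (lam : n.Partition) : lam.conj.diagram = lam.diagram.transpose :=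
  (exists_diagram_eq lam.card_transpose_diagram).choose_spec

theorem conj_conj (lam : n.Partition) : lam.conj.conj = lam :=
  diagram_injective (by rw [diagram_conj, diagram_conj, YoungDiagram.transpose_transpose])

end Nat.Partition

namespace StandardTableau

/-- The transpose of a standard tableau. -/
def transpose {μ : YoungDiagram} (T : StandardTableau μ) : StandardTableau μ.transpose :=
  ⟨(((Equiv.prodComm ℕ ℕ).subtypeEquiv fun c => by simp).trans T.1).trans
      (Equiv.subtypeEquivRight fun i => by rw [YoungDiagram.card_transpose]),
    fun _ _ h h' => T.2.2 _ _ h h', fun _ _ h h' => T.2.1 _ _ h h'⟩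

theorem transpose_injective {μ : YoungDiagram} : Function.Injective (transpose (μ := μ)) := by
  intro S T h
  refine Subtype.ext (Equiv.ext fun c => Subtype.ext ?_)
  exact congrArg (fun R : StandardTableau μ.transpose =>
    (R.1 ⟨c.1.swap, by simp⟩ : ℕ)) h

theorem card_transpose (μ : YoungDiagram) :
    Fintype.card (StandardTableau μ.transpose) = Fintype.card (StandardTableau μ) := by
  -- Transposition is injective both from `μ` and from its transpose, so no inverse map need be
  -- built.
  refine le_antisymm ?_ (Fintype.card_le_of_injective _ transpose_injective)
  refine (Fintype.card_le_of_injective _ (transpose_injective (μ := μ.transpose))).trans ?_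
  rw [YoungDiagram.transpose_transpose]

end StandardTableau

theorem numStandardTableaux_conj {n : ℕ} (lam : n.Partition) :
    numStandardTableaux lam.conj = numStandardTableaux lam := by
  rw [numStandardTableaux, lam.diagram_conj, StandardTableau.card_transpose, numStandardTableaux]

theorem sum_length_eq_sum_entry (n k : ℕ) :
    ∑ lam : n.Partition with lam.length ≤ k, numStandardTableaux lam ^ 2 =
      ∑ lam : n.Partition with lam.entry 0 ≤ k, numStandardTableaux lam ^ 2 := by
  refine Finset.sum_nbij' Nat.Partition.conj Nat.Partition.conj ?_ ?_ ?_ ?_ ?_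
  · intro lam h
    simpa [← Nat.Partition.rowLen_diagram, ← Nat.Partition.colLen_diagram,
      Nat.Partition.diagram_conj] using h
  · intro lam h
    simpa [← Nat.Partition.rowLen_diagram, ← Nat.Partition.colLen_diagram,
      Nat.Partition.diagram_conj] using h
  · exact fun lam _ => lam.conj_conj
  · exact fun lam _ => lam.conj_conj
  · exact fun lam _ => by rw [numStandardTableaux_conj]

/-! ### Counting through pairs of chains -/

/-- The pairs of standard chains with the same end, whose first row has length at most `k`. -/
def chainPairs (n k : ℕ) : Set ((ℕ → ℕ → ℕ) × (ℕ → ℕ → ℕ)) :=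
  {p | IsStandardChain n p.1 ∧ IsStandardChain n p.2 ∧ p.1 n = p.2 n ∧ p.1 n 0 ≤ k}

theorem ncard_avoidsIncreasing (n k : ℕ) :
    {w : Equiv.Perm (Fin n) | AvoidsIncreasing (k + 1) w}.ncard = (chainPairs n k).ncard := by
  refine Set.ncard_congr (fun w _ => (fun i => growth (permMatrix w) (min i n) n,
    fun j => growth (permMatrix w) n (min j n))) ?_ ?_ ?_
  · intro w hw
    exact ⟨isStandardChain_left w, isStandardChain_right w, by simp, by
      simpa using (avoidsIncreasing_iff w k).1 hw⟩
  · intro w v _ _ h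
    exact chains_injective (congrArg Prod.fst h) (congrArg Prod.snd h)
  · rintro ⟨P, Q⟩ ⟨hP, hQ, h, hk⟩
    obtain ⟨w, rfl, rfl⟩ := exists_perm_of_chains hP hQ h
    exact ⟨w, (avoidsIncreasing_iff w k).2 (by simpa using hk), rfl⟩

namespace Nat.Partition

variable {n : ℕ} (lam : n.Partition)

theorem isStandardChain_chain (T : StandardTableau lam.diagram) : IsStandardChain n T.chain := by
  simpa only [lam.card_diagram] using T.isStandardChain_chain

theorem chain_apply (T : StandardTableau lam.diagram) : T.chain n = lam.entry := by
  have := T.chain_card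
  rw [lam.card_diagram] at this
  rw [this]
  exact funext lam.rowLen_diagram

theorem exists_chain_eq {P : ℕ → ℕ → ℕ} (hP : IsStandardChain n P) (h : P n = lam.entry) :
    ∃ T : StandardTableau lam.diagram, T.chain = P := by
  rw [← funext lam.rowLen_diagram] at h
  refine IsStandardChain.exists_chain_eq ?_ ?_ <;> rwa [lam.card_diagram]

theorem entry_injective : Function.Injective (entry (n := n)) := by
  intro lam lam' h
  refine diagram_injective (YoungDiagram.rowLen_injective ?_)
  rw [funext lam.rowLen_diagram, funext lam'.rowLen_diagram, h]

theorem _root_.IsStandardChain.exists_entry_eq {P : ℕ → ℕ → ℕ} (hP : IsStandardChain n P) :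
    ∃ lam : n.Partition, lam.entry = P n := by
  have h0 : ∀ r, n ≤ r → P n r = 0 := fun r => hP.eq_zero le_rfl
  obtain ⟨μ, hμ⟩ := YoungDiagram.exists_rowLen_eq (hP.antitone n) h0
  have hcard : μ.card = n := by
    rw [← μ.sum_rowLen (n := n) (by rwa [hμ]), hμ, hP.sum n le_rfl]
  obtain ⟨lam, rfl⟩ := exists_diagram_eq hcard
  exact ⟨lam, by rw [← hμ]; exact (funext lam.rowLen_diagram).symm⟩

end Nat.Partition

theorem ncard_chainPairs (n k : ℕ) : (chainPairs n k).ncard =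
    ∑ lam : n.Partition with lam.entry 0 ≤ k, numStandardTableaux lam ^ 2 := by
  have h : (Finset.sigma (Finset.univ.filter fun lam : n.Partition => lam.entry 0 ≤ k) fun lam =>
      (Finset.univ : Finset (StandardTableau lam.diagram × StandardTableau lam.diagram))).card =
      ∑ lam : n.Partition with lam.entry 0 ≤ k, numStandardTableaux lam ^ 2 := by
    rw [Finset.card_sigma]
    refine Finset.sum_congr rfl fun lam _ => ?_
    rw [Finset.card_univ, Fintype.card_prod, numStandardTableaux, sq]
  rw [← h, ← Set.ncard_coe_finset]
  symm
  refine Set.ncard_congr (fun T _ => (T.2.1.chain, T.2.2.chain)) ?_ ?_ ?_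
  · rintro ⟨lam, S, T⟩ hk
    refine ⟨lam.isStandardChain_chain S, lam.isStandardChain_chain T, ?_, ?_⟩
    · exact (lam.chain_apply S).trans (lam.chain_apply T).symm
    · simpa [lam.chain_apply S] using hk
  · rintro ⟨lam, S, T⟩ ⟨lam', S', T'⟩ _ _ h
    obtain ⟨h1, h2⟩ := Prod.ext_iff.1 h
    -- The shape is the value of the chain at step `n`.
    have e : lam = lam' := Nat.Partition.entry_injective (by
      rw [← lam.chain_apply S, ← lam'.chain_apply S']
      exact congrFun h1 n)
    subst e
    obtain rfl : S = S' := StandardTableau.chain_injective h1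
    obtain rfl : T = T' := StandardTableau.chain_injective h2
    rfl
  · rintro ⟨P, Q⟩ ⟨hP, hQ, h, hk⟩
    obtain ⟨lam, hl⟩ := hP.exists_entry_eq
    obtain ⟨S, rfl⟩ := lam.exists_chain_eq hP hl.symm
    obtain ⟨T, rfl⟩ := lam.exists_chain_eq hQ (h.symm.trans hl.symm)
    refine ⟨⟨lam, S, T⟩, ?_, rfl⟩
    simpa [lam.chain_apply S] using hk

theorem mainTheorem8 (n k : ℕ) :
    {w : Equiv.Perm (Fin n) | AvoidsIncreasing (k + 1) w}.ncard =
      ∑ lam : n.Partition with lam.length ≤ k, numStandardTableaux lam ^ 2 ∧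
    ∑ lam : n.Partition with lam.length ≤ k, numStandardTableaux lam ^ 2 =
      ∑ lam : n.Partition with lam.entry 0 ≤ k, numStandardTableaux lam ^ 2 := by
  refine ⟨?_, sum_length_eq_sum_entry n k⟩
  rw [sum_length_eq_sum_entry, ncard_avoidsIncreasing, ncard_chainPairs]
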